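/- **Setting.** Let $\mathcal X$ be a Banach space, $\mathsf U$ a normed space, $A:D(A)\subseteq\mathcal X\to\mathcal X$ the generator of a $C_0$-semigroup $T(\cdot)$ on $\mathcal X$, and $f:\mathbb R_{\ge0}\times\mathcal X\times\mathsf U\to\mathcal X$. Consider $$\dot x(t)=Ax(t)+f(t,x(t),u(t)),\qquad x(t_0)=x_0,$$ where the set $\mathcal U$ of admissible inputs consists of all piecewise continuous $u:\mathbb R_{\ge 0}\to\mathsf U$ (on every bounded interval $u$ has finitely many discontinuities, at which the one-sided limits exist). A mild solution on $J=[t_0,\tau)$ or $[t_0,\tau]$ is a continuous $x:J\to\mathcal X$ with $x(t)=T(t-t_0)x_0+\int_{t_0}^tT(t-s)f(s,x(s),u(s))\,ds$ (Bochner integral) for all $t\in J$. For $t_0\ge0$, $x_0\in\mathcal X$, $u\in\mathcal U$, the trajectory $\phi(\cdot,t_0,x_0,u)$ is the maximally defined mild solution, with interval of existence $[t_0,t_{(t_0,x_0,u)})$. The system $\Sigma^{SL}=(\mathcal X,\mathcal U,\phi)$ is forward complete if $t_{(t_0,x_0,u)}=\infty$ for all $t_0\ge 0$, $x_0\in\mathcal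 X$, $u\in\mathcal U$. **Comparison functions.** $\alpha\in\mathcal K$ if $\alpha:\mathbb R_{\ge0}\to\mathbb R_{\ge0}$ is continuous, strictly increasing and $\alpha(0)=0$; $\alpha\in\mathcal K_\infty$ if moreover $\alpha$ is unbounded (then $\alpha(\infty):=\infty$); $\beta\in\mathcal{KL}$ if $\beta:\mathbb R_{\ge0}^2\to\mathbb R_{\ge0}$, $\beta(\cdot,t)\in\mathcal K$ for every $t\ge0$, and $\beta(r,t)$ decreases (not necessarily strictly) to $0$ as $t\to\infty$ for every $r\ge 0$. **Assumptions on $f$.** * (SL1) There are times $0=\tau_0<\tau_1<\tau_2<\cdots$, $\tau_k\to\infty$, and continuous $f_k:[\tau_k,\tau_{k+1}]\times\mathcal X\times\mathsf U\to\mathcal X$ with $f=f_k$ on $[\tau_k,\tau_{k+1})\times\mathcal X\times\mathsf U$, $k=0,1,\dots$ * (SL2) For every $r>0$ there is $L\ge0$ such that $\|f(t,\xi,\mu)-f(t,\omega,\mu)\|\le L\|\xi-\omega\|$ for all $t\ge0$ whenever $\|\xi\|,\|\omega\|,\|\mu\|\le r$. * (SL3) There are $\gamma\in\mathcal K_\infty$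 and a non-decreasing $N:\mathbb R_{\ge0}\to\mathbb R_{>0}$ with $\|f(t,\xi,\mu)\|\le N(\|\xi\|)(1+\gamma(\|\mu\|))$ for all $t\ge0$, $\xi\in\mathcal X$, $\mu\in\mathsf U$. * (SL4) For every $r,\varepsilon>0$ there is $\delta>0$ such that $\|f(t,\xi,\mu)-f(t,\xi,0)\|<\varepsilon$ for all $t\ge0$ whenever $\|\xi\|\le r$ and $\|\mu\|\le\delta$. **Stability notions.** For $\kappa\in\mathcal K_\infty$ put $\|u\|_\kappa:=\int_0^\infty\kappa(\|u(s)\|)\,ds\in[0,\infty]$. * $\Sigma^{SL}$ is 0-GUAS if there is $\beta\in\mathcal{KL}$ such that for all $t_0\ge0$, $x_0\in\mathcal X$ the trajectory for $u=\mathbf 0$ is defined for all $t\ge t_0$ and $\|\phi(t,t_0,x_0,\mathbf 0)\|\le\beta(\|x_0\|,t-t_0)$ for all $t\ge t_0$. * $\Sigma^{SL}$ is iISS with gain $\kappa\in\mathcal K_\infty$ if it is forward complete and there are $\rho\in\mathcal K_\infty$, $\beta\in\mathcal{KL}$ with $\|\phi(t,t_0,x_0,u)\|\le\beta(\|x_0\|,t-t_0)+\rho(\|u\|_\kappa)$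 for all $t\ge t_0\ge0$, $x_0\in\mathcal X$, $u\in\mathcal U$. * $\Sigma^{SL}$ is UBEBS with gain $\kappa\in\mathcal K_\infty$ if it is forward complete and there are $\sigma,\rho\in\mathcal K_\infty$, $c\ge0$ with $\|\phi(t,t_0,x_0,u)\|\le c+\sigma(\|x_0\|)+\rho(\|u\|_\kappa)$ for all $t\ge t_0\ge0$, $x_0\in\mathcal X$, $u\in\mathcal U$. **Theorem.** Suppose that $f$ satisfies (SL1)–(SL4), and let $\gamma\in\mathcal K_\infty$ be the function in (SL3). a) If $\Sigma^{SL}$ is iISS with gain $\kappa$, then $\Sigma^{SL}$ is 0-GUAS and UBEBS with gain $\kappa$. b) If $\Sigma^{SL}$ is 0-GUAS and UBEBS with gain $\alpha$, then $\Sigma^{SL}$ is iISS with gain $\max\{\alpha,\gamma\}$. -/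

import Mathlib

open Set Filter Topology MeasureTheory
open scoped NNReal ENNReal

noncomputable section

namespace IISS

/-! Time is modelled by real numbers; only times `t ≥ 0` ever matter, so that a function on
`[0, ∞)` is represented by a function on `ℝ` whose values at negative times play no role. -/

/-! ### Comparison functions -/

/-- Class `𝒦`: continuous, strictly increasing, zero at zero. -/
structure ClassK (α : ℝ≥0 → ℝ≥0) : Prop where
  continuous : Continuous α
  strictMono : StrictMono α
  map_zero : α 0 = 0

/-- Class `𝒦∞`: class `𝒦` and unbounded. -/
structure ClassKInfty (α : ℝ≥0 → ℝ≥0) : Prop extends ClassK α where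
  unbounded : ∀ M : ℝ≥0, ∃ r : ℝ≥0, M < α r

/-- Class `𝒦ℒ`: `β (·, t)` is of class `𝒦` for every `t ≥ 0`, and `β (r, t)` decreases to zero as
`t → ∞` for every `r ≥ 0`. -/
structure ClassKL (β : ℝ≥0 → ℝ≥0 → ℝ≥0) : Prop where
  classK : ∀ t, ClassK fun r => β r t
  antitone : ∀ r, Antitone (β r)
  tendsto_zero : ∀ r, Tendsto (β r) atTop (𝓝 0)

/-- The extension of `ρ` to `[0, ∞]` by the convention `ρ ∞ = ∞`. -/
def extendTop (ρ : ℝ≥0 → ℝ≥0) (e : ℝ≥0∞) : ℝ≥0∞ :=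
  if e = ∞ then ∞ else (ρ e.toNNReal : ℝ≥0∞)

/-! ### Transition maps and their stability properties -/

/-- A set of admissible inputs together with a transition map
`φ (t, s, x, u)`, which is meaningful for `s ≥ 0`, `u ∈ inputs` and `s ≤ t < maxTime s x u`. -/
structure TransitionSystem (X U : Type*) where
  inputs : Set (ℝ → U)
  maxTime : ℝ → X → (ℝ → U) → EReal
  φ : ℝ → ℝ → X → (ℝ → U) → X

section Stability

variable {X U : Type*} [NormedAddCommGroup X] [NormedAddCommGroup U]

/-- Every trajectory is defined for all times after the initial one. -/
def ForwardComplete (S : TransitionSystem X U) : Prop :=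
  ∀ t₀ : ℝ, 0 ≤ t₀ → ∀ x₀ : X, ∀ u ∈ S.inputs, S.maxTime t₀ x₀ u = ⊤

/-- Zero-input global uniform asymptotic stability. -/
def ZeroGUAS (S : TransitionSystem X U) : Prop :=
  ∃ β : ℝ≥0 → ℝ≥0 → ℝ≥0, ClassKL β ∧
    ∀ t₀ : ℝ, 0 ≤ t₀ → ∀ x₀ : X,
      S.maxTime t₀ x₀ (fun _ => 0) = ⊤ ∧
      ∀ t : ℝ, t₀ ≤ t →
        ‖S.φ t t₀ x₀ (fun _ => 0)‖₊ ≤ β ‖x₀‖₊ (t - t₀).toNNReal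

/-- Input-to-state stability with respect to the input functional `F`. -/
def ISS (S : TransitionSystem X U) (F : (ℝ → U) → ℝ≥0∞) : Prop :=
  ForwardComplete S ∧
  ∃ (ρ : ℝ≥0 → ℝ≥0) (β : ℝ≥0 → ℝ≥0 → ℝ≥0), ClassKInfty ρ ∧ ClassKL β ∧
    ∀ t₀ : ℝ, 0 ≤ t₀ → ∀ x₀ : X, ∀ u ∈ S.inputs, ∀ t : ℝ, t₀ ≤ t →
      (‖S.φ t t₀ x₀ u‖₊ : ℝ≥0∞) ≤
        (β ‖x₀‖₊ (t - t₀).toNNReal : ℝ≥0∞) + extendTop ρ (F u)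

/-- Uniform global boundedness with respect to the input functional `F`. -/
def UGB (S : TransitionSystem X U) (F : (ℝ → U) → ℝ≥0∞) : Prop :=
  ForwardComplete S ∧
  ∃ (α ρ : ℝ≥0 → ℝ≥0) (c : ℝ≥0), ClassKInfty α ∧ ClassKInfty ρ ∧
    ∀ t₀ : ℝ, 0 ≤ t₀ → ∀ x₀ : X, ∀ u ∈ S.inputs, ∀ t : ℝ, t₀ ≤ t →
      (‖S.φ t t₀ x₀ u‖₊ : ℝ≥0∞) ≤ (c : ℝ≥0∞) + (α ‖x₀‖₊ : ℝ≥0∞) + extendTop ρ (F u)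

/-- The input energy `‖u‖_κ = ∫₀^∞ κ (‖u s‖) ds ∈ [0, ∞]`. -/
def energy (κ : ℝ≥0 → ℝ≥0) (u : ℝ → U) : ℝ≥0∞ :=
  ∫⁻ s in Ici (0 : ℝ), (κ ‖u s‖₊ : ℝ≥0∞)

/-- Integral input-to-state stability with gain `κ ∈ 𝒦∞`. -/
def IntegralISS (S : TransitionSystem X U) (κ : ℝ≥0 → ℝ≥0) : Prop :=
  ClassKInfty κ ∧ ISS S (energy κ)

/-- Uniformly bounded-energy input / bounded state, with gain `κ ∈ 𝒦∞`. -/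
def UBEBS (S : TransitionSystem X U) (κ : ℝ≥0 → ℝ≥0) : Prop :=
  ClassKInfty κ ∧ UGB S (energy κ)

end Stability

/-! ### Semilinear systems -/

section Semilinear

variable {X U : Type*} [NormedAddCommGroup X] [NormedSpace ℝ X] [NormedAddCommGroup U]

/-- `T` is a strongly continuous semigroup of bounded operators on `X`. -/
structure IsC0Semigroup (T : ℝ → X →L[ℝ] X) : Prop where
  zero : T 0 = ContinuousLinearMap.id ℝ X
  add : ∀ s t : ℝ, 0 ≤ s → 0 ≤ t → T (s + t) = (T s).comp (T t)
  continuousOn : ∀ x : X, ContinuousOn (fun t => T t x) (Ici 0)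

/-- `A` is the infinitesimal generator of `T`: `x ∈ D(A)` and `A x = y` if and only if
`(T h x - x) / h → y` as `h → 0⁺`. -/
def IsGenerator (A : X →ₗ.[ℝ] X) (T : ℝ → X →L[ℝ] X) : Prop :=
  ∀ x y : X, (x, y) ∈ A.graph ↔
    Tendsto (fun h : ℝ => h⁻¹ • (T h x - x)) (𝓝[>] 0) (𝓝 y)

/-- A strictly increasing and unbounded sequence of times `0 = τ 0 < τ 1 < ⋯`. -/
structure IsTimePartition (τ : ℕ → ℝ) : Prop where
  zero : τ 0 = 0
  strictMono : StrictMono τ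
  unbounded : Tendsto τ atTop atTop

/-- Piecewise continuity on `[0, ∞)`: on every bounded interval, continuity off finitely many
points, at which the one-sided limits exist (the value there is arbitrary). -/
def PiecewiseContinuous (u : ℝ → U) : Prop :=
  ∃ τ : ℕ → ℝ, IsTimePartition τ ∧
    ∀ k, ∃ g : ℝ → U, ContinuousOn g (Icc (τ k) (τ (k + 1))) ∧
      EqOn u g (Ioo (τ k) (τ (k + 1)))

/-- The conditions (SL1)-(SL4) on the nonlinearity `f`, with `γ` the function in (SL3). -/
structure SemilinearAssumption (f : ℝ → X → U → X) (γ : ℝ≥0 → ℝ≥0) : Prop where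
  sl1 : ∃ τ : ℕ → ℝ, IsTimePartition τ ∧
    ∀ k, ∃ g : ℝ → X → U → X,
      ContinuousOn (fun p : ℝ × X × U => g p.1 p.2.1 p.2.2)
        (Icc (τ k) (τ (k + 1)) ×ˢ univ) ∧
      ∀ t ∈ Ico (τ k) (τ (k + 1)), ∀ ξ μ, f t ξ μ = g t ξ μ
  sl2 : ∀ r : ℝ, 0 < r → ∃ L : ℝ, 0 ≤ L ∧
    ∀ ξ ω : X, ‖ξ‖ ≤ r → ‖ω‖ ≤ r → ∀ μ : U, ‖μ‖ ≤ r → ∀ t : ℝ, 0 ≤ t →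
      ‖f t ξ μ - f t ω μ‖ ≤ L * ‖ξ - ω‖
  sl3_gain : ClassKInfty γ
  sl3 : ∃ N : ℝ≥0 → ℝ≥0, Monotone N ∧ (∀ r, 0 < N r) ∧
    ∀ t : ℝ, 0 ≤ t → ∀ (ξ : X) (μ : U), ‖f t ξ μ‖₊ ≤ N ‖ξ‖₊ * (1 + γ ‖μ‖₊)
  sl4 : ∀ r : ℝ, 0 < r → ∀ ε : ℝ, 0 < ε → ∃ δ : ℝ, 0 < δ ∧
    ∀ t : ℝ, 0 ≤ t → ∀ (ξ : X) (μ : U), ‖ξ‖ ≤ r → ‖μ‖ ≤ δ →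
      ‖f t ξ μ - f t ξ 0‖ < ε

/-- `x` is a mild solution of `x' = A x + f (t, x, u)`, `x t₀ = x₀`, on the interval `J` with left
end point `t₀ ∈ J`: a continuous function that satisfies the variation of constants formula. -/
def IsMildSolution (T : ℝ → X →L[ℝ] X) (f : ℝ → X → U → X) (t₀ : ℝ) (x₀ : X) (u : ℝ → U)
    (J : Set ℝ) (x : ℝ → X) : Prop :=
  ContinuousOn x J ∧ ∀ t ∈ J,
    IntervalIntegrable (fun s => T (t - s) (f s (x s) (u s))) volume t₀ t ∧
    x t = T (t - t₀) x₀ + ∫ s in t₀..t, T (t - s) (f s (x s) (u s))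

/-- `x` is a mild solution on `[t₀, b)`, where `t₀ < b ≤ ∞`, and no mild solution of the same
initial value problem lives on a longer interval `[t₀, b')`. -/
structure IsMaximalMildSolution (T : ℝ → X →L[ℝ] X) (f : ℝ → X → U → X) (t₀ : ℝ) (x₀ : X)
    (u : ℝ → U) (b : EReal) (x : ℝ → X) : Prop where
  lt : (t₀ : EReal) < b
  isMildSolution : IsMildSolution T f t₀ x₀ u {t : ℝ | t₀ ≤ t ∧ (t : EReal) < b} x
  maximal : ∀ (b' : EReal) (y : ℝ → X),
    IsMildSolution T f t₀ x₀ u {t : ℝ | t₀ ≤ t ∧ (t : EReal) < b'} y → b' ≤ b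

open scoped Classical in
/-- The maximal mild solution with its maximal existence time (a dummy with an empty interval of
existence if there is none). -/
def maximalSolution (T : ℝ → X →L[ℝ] X) (f : ℝ → X → U → X) (t₀ : ℝ) (x₀ : X)
    (u : ℝ → U) : EReal × (ℝ → X) :=
  if h : ∃ p : EReal × (ℝ → X), IsMaximalMildSolution T f t₀ x₀ u p.1 p.2 then h.choose
  else ((t₀ : EReal), fun _ => 0)

/-- The system generated by `x' = A x + f (t, x, u)`, where `A` generates `T`: the inputs are the
piecewise continuous functions and the trajectories are the maximal mild solutions. -/
def semilinearSystem (T : ℝ → X →L[ℝ] X) (f : ℝ → X → U → X) : TransitionSystem X U where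
  inputs := {u | PiecewiseContinuous u}
  maxTime t₀ x₀ u := (maximalSolution T f t₀ x₀ u).1
  φ t t₀ x₀ u := (maximalSolution T f t₀ x₀ u).2 t

end Semilinear

end IISS

end

/-! Part a) is read off from the iISS estimate: zero input has zero energy, and `β r t ≤ β r 0`.

Part b) rests on one perturbation estimate (`SemilinearAssumption.exists_norm_sub_le`): on a window
of fixed length, a bounded trajectory stays close to the zero-input trajectory from the same state,
provided the input energy in the window is small. By (SL3) and (SL4), on bounded sets `‖f t ξ μ - f
t ξ 0‖ ≤ η + C * γ ‖μ‖₊` with `η` arbitrarily small. The variation of constants formula, the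
Lipschitz condition (SL2) and Grönwall's inequality then give closeness. The gain must dominate `γ`,
hence the maximum with `γ`.

The rest uses only this closeness, 0-GUAS, UBEBS and the cocycle identity. Near the origin, a small
state subject to small energy returns to a small ball after each window, so the additive constant of
UBEBS can be removed: trajectories are bounded by `θ ‖x₀‖₊ + θ e`, where `e` bounds the energy. For
attraction, a long enough run of consecutive windows must contain one of low energy. In it the
trajectory nearly follows the decaying zero-input trajectory and so becomes small; restarting there,
the bound with `θ` keeps it below `ε + 2 θ e`. Boundedness and uniform attraction are finally merged
into a single function of class `𝒦ℒ`. -/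

noncomputable section

namespace IISS

/-! ### Construction of comparison functions -/

/-- The average of `a` over `[r, 2 r]`, written as an integral over dilations. -/
def dilationAverage (a : ℝ≥0 → ℝ≥0) (r : ℝ≥0) : ℝ≥0 :=
  Real.toNNReal (∫ l in (1 : ℝ)..2, (a (r * l.toNNReal) : ℝ))

theorem intervalIntegrable_dilation {a : ℝ≥0 → ℝ≥0} (ha : Monotone a) (r : ℝ≥0) (p q : ℝ) :
    IntervalIntegrable (fun l : ℝ => (a (r * l.toNNReal) : ℝ)) volume p q := by
  apply Monotone.intervalIntegrable
  intro l m hlm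
  exact NNReal.coe_le_coe.2 (ha (mul_le_mul_right (Real.toNNReal_mono hlm) r))

theorem coe_dilationAverage (a : ℝ≥0 → ℝ≥0) (r : ℝ≥0) :
    (dilationAverage a r : ℝ) = ∫ l in (1 : ℝ)..2, (a (r * l.toNNReal) : ℝ) :=
  Real.coe_toNNReal _
    (intervalIntegral.integral_nonneg (by norm_num) fun _ _ => NNReal.coe_nonneg _)

/-- Letting both the function and the argument vary serves monotonicity in the size and, for the
`𝒦ℒ` majorant, in time. -/
theorem dilationAverage_mono {a b : ℝ≥0 → ℝ≥0} (ha : Monotone a) (hb : Monotone b)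
    {r s : ℝ≥0} (h : ∀ l, a (r * l) ≤ b (s * l)) : dilationAverage a r ≤ dilationAverage b s := by
  rw [← NNReal.coe_le_coe, coe_dilationAverage, coe_dilationAverage]
  exact intervalIntegral.integral_mono_on (by norm_num) (intervalIntegrable_dilation ha _ _ _)
    (intervalIntegrable_dilation hb _ _ _) fun l _ => NNReal.coe_le_coe.2 (h _)

theorem monotone_dilationAverage {a : ℝ≥0 → ℝ≥0} (ha : Monotone a) :
    Monotone (dilationAverage a) := fun _ _ hrs =>
  dilationAverage_mono ha ha fun l => ha (mul_le_mul_left hrs l)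

theorem le_dilationAverage {a : ℝ≥0 → ℝ≥0} (ha : Monotone a) (r : ℝ≥0) :
    a r ≤ dilationAverage a r := by
  rw [← NNReal.coe_le_coe, coe_dilationAverage]
  have h := intervalIntegral.integral_mono_on (μ := volume) (a := 1) (b := 2)
    (f := fun _ => (a r : ℝ)) (by norm_num) intervalIntegrable_const
    (intervalIntegrable_dilation ha r 1 2) fun l hl => NNReal.coe_le_coe.2 (ha (by
      have : (1 : ℝ≥0) ≤ l.toNNReal := by simpa using Real.toNNReal_mono hl.1
      simpa using mul_le_mul_right this r))
  norm_num at h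
  exact h

theorem dilationAverage_le {a : ℝ≥0 → ℝ≥0} (ha : Monotone a) (r : ℝ≥0) :
    dilationAverage a r ≤ a (r * 2) := by
  rw [← NNReal.coe_le_coe, coe_dilationAverage]
  have h := intervalIntegral.integral_mono_on (μ := volume) (a := 1) (b := 2)
    (g := fun _ => (a (r * 2) : ℝ)) (by norm_num) (intervalIntegrable_dilation ha r 1 2)
    intervalIntegrable_const fun l hl => NNReal.coe_le_coe.2 (ha (by
      have : l.toNNReal ≤ (2 : ℝ≥0) := by simpa using Real.toNNReal_mono hl.2
      exact mul_le_mul_right this r))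
  norm_num at h
  exact h

/-- Away from zero, rescaling turns the average into a difference quotient `(P (2 r) - P r) / r` of
a primitive `P`, which is continuous even if `a` jumps. At zero the average is squeezed between `0`
and `a (2 r)`. -/
theorem continuous_dilationAverage {a : ℝ≥0 → ℝ≥0} (ha : Monotone a) (h0 : a 0 = 0)
    (hc : ContinuousAt a 0) : Continuous (dilationAverage a) := by
  rw [continuous_iff_continuousAt]
  intro r
  rcases eq_or_ne r 0 with rfl | hr
  · have h00 : dilationAverage a 0 = 0 := by
      apply le_antisymm _ zero_le
      simpa [h0] using dilationAverage_le ha 0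
    rw [ContinuousAt, h00]
    have h2 : Tendsto (fun s : ℝ≥0 => a (s * 2)) (𝓝 0) (𝓝 0) := by
      have : Tendsto (fun s : ℝ≥0 => s * 2) (𝓝 0) (𝓝 0) := by
        have h : Continuous fun s : ℝ≥0 => s * 2 := by fun_prop
        simpa using h.tendsto 0
      have hc' : Tendsto a (𝓝 0) (𝓝 0) := by simpa [ContinuousAt, h0] using hc
      exact hc'.comp this
    exact tendsto_of_tendsto_of_tendsto_of_le_of_le tendsto_const_nhds h2
      (fun _ => zero_le) (dilationAverage_le ha)
  · set P : ℝ → ℝ := fun t => ∫ x in (0 : ℝ)..t, (a x.toNNReal : ℝ) with hP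
    have hint : ∀ p q : ℝ, IntervalIntegrable (fun x : ℝ => (a x.toNNReal : ℝ)) volume p q := by
      intro p q
      simpa using intervalIntegrable_dilation ha 1 p q
    have hPc : Continuous P := intervalIntegral.continuous_primitive hint 0
    have key : ∀ s : ℝ≥0, s ≠ 0 →
        dilationAverage a s = Real.toNNReal ((s : ℝ)⁻¹ * (P (s * 2) - P s)) := by
      intro s hs
      have hs' : (s : ℝ) ≠ 0 := by exact_mod_cast hs
      have h1 := intervalIntegral.integral_comp_mul_left (a := 1) (b := 2)
        (fun x : ℝ => (a x.toNNReal : ℝ)) hs'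
      simp only [Real.toNNReal_mul s.coe_nonneg, Real.toNNReal_coe, mul_one, smul_eq_mul] at h1
      rw [dilationAverage, h1, hP]
      simp only
      rw [intervalIntegral.integral_interval_sub_left (hint _ _) (hint _ _)]
    have hev : dilationAverage a =ᶠ[𝓝 r]
        fun s => Real.toNNReal ((s : ℝ)⁻¹ * (P (s * 2) - P s)) := by
      filter_upwards [isOpen_ne.mem_nhds hr] with s hs using key s hs
    refine ContinuousAt.congr ?_ hev.symm
    have hr' : (r : ℝ) ≠ 0 := by exact_mod_cast hr
    refine continuous_real_toNNReal.continuousAt.comp ?_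
    refine ContinuousAt.mul (ContinuousAt.inv₀ (by fun_prop) hr') ?_
    fun_prop

/-- A monotone function that is continuous at its zero `0` has a majorant of class `𝒦`. -/
theorem classK_dilationAverage_add {a : ℝ≥0 → ℝ≥0} (ha : Monotone a) (h0 : a 0 = 0)
    (hc : ContinuousAt a 0) {c : ℝ≥0} (hcpos : 0 < c) :
    ClassK fun r => dilationAverage a r + c * r where
  continuous := (continuous_dilationAverage ha h0 hc).add (by fun_prop)
  strictMono := fun _ _ hrs => add_lt_add_of_le_of_lt (monotone_dilationAverage ha hrs.le)
    (mul_lt_mul_of_pos_left hrs hcpos)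
  map_zero := by
    have := dilationAverage_le ha 0
    simp only [zero_mul, h0, nonpos_iff_eq_zero] at this
    simp [this]

theorem continuousAt_zero_of_small {a : ℝ≥0 → ℝ≥0} (ha : Monotone a)
    (h : ∀ ε, 0 < ε → ∃ δ, 0 < δ ∧ a δ ≤ ε) : a 0 = 0 ∧ ContinuousAt a 0 := by
  have h0 : a 0 = 0 := by
    refine le_antisymm (le_of_forall_pos_le_add fun ε hε => ?_) zero_le
    obtain ⟨δ, -, hδ⟩ := h ε hε
    simpa using (ha zero_le).trans hδ
  refine ⟨h0, ?_⟩
  rw [ContinuousAt, h0]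
  refine tendsto_order.2 ⟨fun b hb => absurd hb (not_lt.2 zero_le), fun ε hε => ?_⟩
  obtain ⟨δ, hδ, hδε⟩ := h (ε / 2) (half_pos hε)
  filter_upwards [Iio_mem_nhds hδ] with s hs
  exact ((ha (le_of_lt hs)).trans hδε).trans_lt (NNReal.half_lt_self hε.ne')

/-- Quantities that are bounded in terms of a size, and small when the size is small, are bounded
by a function of class `𝒦∞` of the size. -/
theorem exists_classKInfty_majorant (P : ℝ≥0 → ℝ≥0 → Prop)
    (hbdd : ∀ r, ∃ B, ∀ n v, P n v → n ≤ r → v ≤ B)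
    (hsmall : ∀ ε, 0 < ε → ∃ δ, 0 < δ ∧ ∀ n v, P n v → n ≤ δ → v ≤ ε) :
    ∃ θ, ClassKInfty θ ∧ ∀ n v, P n v → v ≤ θ n := by
  set S : ℝ≥0 → Set ℝ≥0 := fun r => {v | ∃ n, P n v ∧ n ≤ r}
  have hS : ∀ r, BddAbove (S r) := fun r => by
    obtain ⟨B, hB⟩ := hbdd r
    exact ⟨B, fun v ⟨n, hP, hn⟩ => hB n v hP hn⟩
  have hle : ∀ {r B}, (∀ n v, P n v → n ≤ r → v ≤ B) → sSup (S r) ≤ B :=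
    fun h => csSup_le' fun v ⟨n, hP, hn⟩ => h n v hP hn
  have hmono : Monotone fun r => sSup (S r) := fun r s hrs =>
    csSup_le' fun v ⟨n, hP, hn⟩ => le_csSup (hS s) ⟨n, hP, hn.trans hrs⟩
  obtain ⟨h0, hc⟩ := continuousAt_zero_of_small hmono fun ε hε => by
    obtain ⟨δ, hδ, h⟩ := hsmall ε hε
    exact ⟨δ, hδ, hle h⟩
  -- The added linear term `1 * r` supplies both strict monotonicity and unboundedness.
  refine ⟨_, ⟨classK_dilationAverage_add hmono h0 hc one_pos, fun M => ⟨M + 1, ?_⟩⟩,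
    fun n v hP => ?_⟩
  · exact lt_of_lt_of_le (by simp) (le_add_left (le_refl (1 * (M + 1))))
  · exact (le_csSup (hS n) ⟨n, hP, le_rfl⟩).trans
      ((le_dilationAverage hmono n).trans (le_add_right le_rfl))

theorem tendsto_inv_one_add : Tendsto (fun t : ℝ≥0 => (1 + t)⁻¹) atTop (𝓝 0) := by
  rw [← NNReal.tendsto_coe]
  push_cast
  exact tendsto_inv_atTop_zero.comp
    (tendsto_atTop_add_const_left _ _ (NNReal.tendsto_coe_atTop.2 tendsto_id))

/-- Quantities that are bounded by a function of class `𝒦∞` of a size, and small after a time that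
depends only on the size, are bounded by a function of class `𝒦ℒ` of size and time. -/
theorem exists_classKL_majorant (P : ℝ≥0 → ℝ≥0 → ℝ≥0 → Prop) {θ : ℝ≥0 → ℝ≥0}
    (hθ : ClassKInfty θ) (hbdd : ∀ n t v, P n t v → v ≤ θ n)
    (hattr : ∀ r ε, 0 < ε → ∃ T, ∀ n t v, P n t v → n ≤ r → T ≤ t → v ≤ ε) :
    ∃ β, ClassKL β ∧ ∀ n t v, P n t v → v ≤ β n t := by
  -- All times `s ≥ t` enter the supremum, which makes it decreasing in `t`.
  set S : ℝ≥0 → ℝ≥0 → Set ℝ≥0 := fun t r => {v | ∃ n s, P n s v ∧ n ≤ r ∧ t ≤ s}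
  set a : ℝ≥0 → ℝ≥0 → ℝ≥0 := fun t r => sSup (S t r)
  have hS : ∀ t r, BddAbove (S t r) := fun t r =>
    ⟨θ r, fun v ⟨n, s, hP, hn, _⟩ => (hbdd n s v hP).trans (hθ.strictMono.monotone hn)⟩
  have haθ : ∀ t r, a t r ≤ θ r := fun t r =>
    csSup_le' fun v ⟨n, s, hP, hn, _⟩ => (hbdd n s v hP).trans (hθ.strictMono.monotone hn)
  have hmono : ∀ t, Monotone (a t) := fun t r r' hrr => csSup_le' fun v ⟨n, s, hP, hn, hs⟩ =>
    le_csSup (hS t r') ⟨n, s, hP, hn.trans hrr, hs⟩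
  have hanti : ∀ r t t', t ≤ t' → a t' r ≤ a t r := fun r t t' htt =>
    csSup_le' fun v ⟨n, s, hP, hn, hs⟩ => le_csSup (hS t r) ⟨n, s, hP, hn, htt.trans hs⟩
  have hcont : ∀ t, a t 0 = 0 ∧ ContinuousAt (a t) 0 := fun t =>
    continuousAt_zero_of_small (hmono t) fun ε hε => by
      have h : Tendsto θ (𝓝 0) (𝓝 0) := by
        simpa [hθ.map_zero] using hθ.continuous.tendsto 0
      have h' : ∀ᶠ δ in 𝓝[>] (0 : ℝ≥0), θ δ < ε :=
        (h.eventually (gt_mem_nhds hε)).filter_mono nhdsWithin_le_nhds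
      obtain ⟨δ, hδ, hδ0⟩ := (h'.and self_mem_nhdsWithin).exists
      exact ⟨δ, hδ0, (haθ t δ).trans hδ.le⟩
  -- The slope `(1 + t)⁻¹` makes the majorant strictly increasing in `r` at each time and still
  -- vanishes as `t → ∞`.
  have hpos : ∀ t : ℝ≥0, 0 < (1 + t)⁻¹ := fun t => inv_pos.2 (by positivity)
  refine ⟨fun r t => dilationAverage (a t) r + (1 + t)⁻¹ * r, ⟨fun t =>
    classK_dilationAverage_add (hmono t) (hcont t).1 (hcont t).2 (hpos t), fun r t t' htt => ?_,
    fun r => ?_⟩, fun n t v hP => ?_⟩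
  · refine add_le_add (dilationAverage_mono (hmono _) (hmono _) fun l => hanti _ _ _ htt) ?_
    refine mul_le_mul_left ?_ r
    exact inv_anti₀ (by positivity) (by gcongr)
  · have h1 : Tendsto (fun t => dilationAverage (a t) r) atTop (𝓝 0) := by
      refine tendsto_order.2 ⟨fun b hb => absurd hb (not_lt.2 zero_le), fun ε hε => ?_⟩
      -- Attraction is needed for sizes up to `2 r`, since the average over `[r, 2 r]` is at most
      -- the value at `2 r`.
      obtain ⟨T, hT⟩ := hattr (r * 2) (ε / 2) (half_pos hε)
      filter_upwards [eventually_ge_atTop T] with t ht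
      refine ((dilationAverage_le (hmono t) r).trans (csSup_le' ?_)).trans_lt
        (NNReal.half_lt_self hε.ne')
      rintro v ⟨n, s, hP, hn, hs⟩
      exact hT n s v hP hn (ht.trans hs)
    have h2 : Tendsto (fun t : ℝ≥0 => (1 + t)⁻¹ * r) atTop (𝓝 0) := by
      simpa using tendsto_inv_one_add.mul_const r
    simpa using h1.add h2
  · exact (le_csSup (hS t n) ⟨n, t, hP, le_rfl, le_rfl⟩).trans
      ((le_dilationAverage (hmono t) n).trans (le_add_right le_rfl))

section

/-! ### Mild solutions -/

theorem PiecewiseContinuous.exists_norm_le {U : Type*} [NormedAddCommGroup U] {u : ℝ → U}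
    (hu : PiecewiseContinuous u) (b : ℝ) : ∃ B : ℝ, ∀ t ∈ Icc 0 b, ‖u t‖ ≤ B := by
  obtain ⟨τ, hτ, h⟩ := hu
  have key : ∀ k, ∃ B : ℝ, ∀ t ∈ Icc 0 (τ k), ‖u t‖ ≤ B := by
    intro k
    induction k with
    | zero =>
      refine ⟨‖u 0‖, fun t ht => ?_⟩
      rw [hτ.zero] at ht
      rw [le_antisymm ht.2 ht.1]
    | succ k ih =>
      obtain ⟨B, hB⟩ := ih
      obtain ⟨g, hg, hug⟩ := h k
      obtain ⟨C, hC⟩ := isCompact_Icc.exists_bound_of_continuousOn hg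
      refine ⟨max (max B C) ‖u (τ (k + 1))‖, fun t ht => ?_⟩
      rcases le_or_gt t (τ k) with h1 | h1
      · exact (hB t ⟨ht.1, h1⟩).trans ((le_max_left _ _).trans (le_max_left _ _))
      rcases ht.2.lt_or_eq with h2 | h2
      · rw [hug ⟨h1, h2⟩]
        exact (hC t ⟨h1.le, h2.le⟩).trans ((le_max_right _ _).trans (le_max_left _ _))
      · rw [h2]
        exact le_max_right _ _
  obtain ⟨k, hk⟩ := (hτ.unbounded.eventually_ge_atTop b).exists
  obtain ⟨B, hB⟩ := key k
  exact ⟨B, fun t ht => hB t ⟨ht.1, ht.2.trans hk⟩⟩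

theorem piecewiseContinuous_zero {U : Type*} [NormedAddCommGroup U] :
    PiecewiseContinuous (fun _ : ℝ => (0 : U)) :=
  ⟨fun k => (k : ℝ), ⟨by simp, Nat.strictMono_cast, tendsto_natCast_atTop_atTop⟩,
    fun _ => ⟨fun _ => 0, continuousOn_const, fun _ _ => rfl⟩⟩

/-- Grönwall's inequality in integral form. -/
theorem le_mul_exp_of_le_add_integral {w : ℝ → ℝ} {a b A K : ℝ} (hw : ContinuousOn w (Icc a b))
    (h0 : ∀ t ∈ Icc a b, 0 ≤ w t) (hK : 0 ≤ K)
    (h : ∀ t ∈ Icc a b, w t ≤ A + K * ∫ r in a..t, w r) :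
    ∀ t ∈ Icc a b, w t ≤ A * Real.exp (K * (t - a)) := by
  intro t ht
  have hab : a ≤ b := ht.1.trans ht.2
  -- Extending `w` by constants outside `[a, b]` makes its primitive differentiable everywhere,
  -- endpoints included.
  set v : ℝ → ℝ := IccExtend hab ((Icc a b).domRestrict w)
  have hv : Continuous v := (continuousOn_iff_continuous_domRestrict.1 hw).Icc_extend'
  have hvw : ∀ r ∈ Icc a b, v r = w r := fun r hr => IccExtend_of_mem hab _ hr
  set W : ℝ → ℝ := fun t => A + K * ∫ r in a..t, v r
  have hW : ∀ r, HasDerivAt W (K * v r) r := fun r =>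
    ((intervalIntegral.integral_hasDerivAt_right (hv.intervalIntegrable _ _)
      hv.stronglyMeasurable.stronglyMeasurableAtFilter hv.continuousAt).const_mul K).const_add A
  have hwW : ∀ r ∈ Icc a b, w r ≤ W r := by
    intro r hr
    refine (h r hr).trans_eq ?_
    simp only [W]
    rw [intervalIntegral.integral_congr (g := v)]
    intro q hq
    rw [uIcc_of_le hr.1] at hq
    exact (hvw q ⟨hq.1, hq.2.trans hr.2⟩).symm
  have hW0 : ∀ r ∈ Icc a b, 0 ≤ W r := fun r hr => (h0 r hr).trans (hwW r hr)
  have hWa : W a = A := by simp [W]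
  have := norm_le_gronwallBound_of_norm_deriv_right_le (f := W) (f' := fun r => K * v r)
    (δ := A) (K := K) (ε := 0) (a := a) (b := b)
    (fun r _ => (hW r).continuousAt.continuousWithinAt) (fun r _ => (hW r).hasDerivWithinAt)
    (by rw [Real.norm_of_nonneg (hW0 a ⟨le_rfl, hab⟩), hWa])
    (fun r hr => by
      have hr' := Ico_subset_Icc_self hr
      rw [hvw r hr', Real.norm_of_nonneg (mul_nonneg hK (h0 r hr')),
        Real.norm_of_nonneg (hW0 r hr'), add_zero]
      exact mul_le_mul_of_nonneg_left (hwW r hr') hK) t ht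
  rw [gronwallBound_ε0, Real.norm_of_nonneg (hW0 t ht)] at this
  exact (hwW t ht).trans this

variable {X U : Type*} [NormedAddCommGroup X] [NormedSpace ℝ X]
  {T : ℝ → X →L[ℝ] X} {f : ℝ → X → U → X} {γ : ℝ≥0 → ℝ≥0}

theorem IsC0Semigroup.exists_norm_le [CompleteSpace X] (hT : IsC0Semigroup T) (τ : ℝ) :
    ∃ M : ℝ, 0 ≤ M ∧ ∀ t ∈ Icc 0 τ, ‖T t‖ ≤ M := by
  obtain ⟨C, hC⟩ := banach_steinhaus (g := fun t : Icc (0 : ℝ) τ => T t) fun x => by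
    obtain ⟨C, hC⟩ := isCompact_Icc.exists_bound_of_continuousOn
      ((hT.continuousOn x).mono (Icc_subset_Ici_self : Icc 0 τ ⊆ Ici 0))
    exact ⟨C, fun t => hC t t.2⟩
  exact ⟨max C 0, le_max_right _ _, fun t ht => (hC ⟨t, ht⟩).trans (le_max_left _ _)⟩

/-- A mild solution restarted at a later time is a mild solution. -/
theorem IsMildSolution.restart [CompleteSpace X] (hT : IsC0Semigroup T) {t₀ s : ℝ} {x₀ : X}
    {u : ℝ → U} {x : ℝ → X} (hx : IsMildSolution T f t₀ x₀ u (Ici t₀) x) (hs : t₀ ≤ s) :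
    IsMildSolution T f s (x s) u (Ici s) x := by
  refine ⟨hx.1.mono (Ici_subset_Ici.2 hs), fun t ht => ?_⟩
  obtain ⟨hi, he⟩ := hx.2 t (hs.trans ht)
  obtain ⟨hi', he'⟩ := hx.2 s hs
  have hst : s ≤ t := ht
  have h1 : IntervalIntegrable (fun r => T (t - r) (f r (x r) (u r))) volume t₀ s :=
    hi.mono_set (by
      rw [uIcc_of_le hs, uIcc_of_le (hs.trans hst)]; exact Icc_subset_Icc_right hst)
  have h2 : IntervalIntegrable (fun r => T (t - r) (f r (x r) (u r))) volume s t :=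
    hi.mono_set (by
      rw [uIcc_of_le hst, uIcc_of_le (hs.trans hst)]; exact Icc_subset_Icc_left hs)
  refine ⟨h2, ?_⟩
  have hadd : ∀ r, r ≤ s → ∀ z, T (t - s) (T (s - r) z) = T (t - r) z := by
    intro r hr z
    rw [show t - r = (t - s) + (s - r) by ring, hT.add _ _ (sub_nonneg.2 hst) (sub_nonneg.2 hr)]
    rfl
  conv_rhs => rw [he']
  rw [he, map_add, hadd _ hs, ← ContinuousLinearMap.intervalIntegral_comp_comm _ hi',
    ← intervalIntegral.integral_add_adjacent_intervals h1 h2, add_assoc]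
  congr 2
  refine intervalIntegral.integral_congr fun r hr => ?_
  rw [uIcc_of_le hs] at hr
  exact (hadd r hr.2 _).symm

/-- Two mild solutions with the same initial value stay close if the nonlinear terms along them
differ by a Lipschitz term and a term with small integral. -/
theorem IsMildSolution.norm_sub_le {s b : ℝ} {ξ : X} {u v : ℝ → U} {x y : ℝ → X}
    (hx : IsMildSolution T f s ξ u (Ici s) x) (hy : IsMildSolution T f s ξ v (Ici s) y)
    {M L G : ℝ} (hM0 : 0 ≤ M) (hM : ∀ t ∈ Icc 0 (b - s), ‖T t‖ ≤ M) (hL : 0 ≤ L)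
    (hG : 0 ≤ G) {g : ℝ → ℝ≥0∞} (hg : ∫⁻ r in Ioc s b, g r ≤ ENNReal.ofReal G)
    (hfg : ∀ r ∈ Ioc s b, ‖f r (x r) (u r) - f r (y r) (v r)‖ₑ ≤
      ENNReal.ofReal (L * ‖x r - y r‖) + g r) :
    ∀ t ∈ Icc s b, ‖x t - y t‖ ≤ M * G * Real.exp (M * L * (t - s)) := by
  have hw : ContinuousOn (fun r => ‖x r - y r‖) (Ici s) := (hx.1.sub hy.1).norm
  refine le_mul_exp_of_le_add_integral (hw.mono Icc_subset_Ici_self) (fun _ _ => norm_nonneg _)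
    (mul_nonneg hM0 hL) fun t ht => ?_
  obtain ⟨hxi, hxe⟩ := hx.2 t ht.1
  obtain ⟨hyi, hye⟩ := hy.2 t ht.1
  have hwi : IntegrableOn (fun r => L * ‖x r - y r‖) (Ioc s t) :=
    ((hw.mono Icc_subset_Ici_self).integrableOn_Icc.mono_set Ioc_subset_Icc_self).const_mul L
  have hint0 : 0 ≤ ∫ r in Ioc s t, L * ‖x r - y r‖ :=
    integral_nonneg fun _ => mul_nonneg hL (norm_nonneg _)
  have hsub : x t - y t = ∫ r in Ioc s t,
      (T (t - r) (f r (x r) (u r)) - T (t - r) (f r (y r) (v r))) := by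
    rw [hxe, hye, add_sub_add_left_eq_sub, ← intervalIntegral.integral_sub hxi hyi,
      intervalIntegral.integral_of_le ht.1]
  -- Working with lower integrals avoids any measurability requirement on `g`; only the Lipschitz
  -- term has to be measurable.
  have hmain : ‖x t - y t‖ₑ ≤
      ENNReal.ofReal (M * ((∫ r in Ioc s t, L * ‖x r - y r‖) + G)) := calc
    ‖x t - y t‖ₑ ≤ ∫⁻ r in Ioc s t,
        ‖T (t - r) (f r (x r) (u r)) - T (t - r) (f r (y r) (v r))‖ₑ := by
      rw [hsub]; exact enorm_integral_le_lintegral_enorm _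
    _ ≤ ∫⁻ r in Ioc s t, ENNReal.ofReal M * (ENNReal.ofReal (L * ‖x r - y r‖) + g r) := by
      refine setLIntegral_mono' measurableSet_Ioc fun r hr => ?_
      rw [← map_sub]
      refine (ContinuousLinearMap.le_opENorm _ _).trans
        (mul_le_mul' ?_ (hfg r ⟨hr.1, hr.2.trans ht.2⟩))
      rw [← ofReal_norm]
      exact ENNReal.ofReal_le_ofReal (hM _ ⟨sub_nonneg.2 hr.2, by linarith [hr.1, ht.2]⟩)
    _ = ENNReal.ofReal M * (ENNReal.ofReal (∫ r in Ioc s t, L * ‖x r - y r‖) +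
        ∫⁻ r in Ioc s t, g r) := by
      rw [lintegral_const_mul' _ _ ENNReal.ofReal_ne_top, lintegral_add_left'
        hwi.aemeasurable.ennreal_ofReal, ofReal_integral_eq_lintegral_ofReal hwi
        (Eventually.of_forall fun _ => mul_nonneg hL (norm_nonneg _))]
    _ ≤ ENNReal.ofReal M * (ENNReal.ofReal (∫ r in Ioc s t, L * ‖x r - y r‖) +
        ENNReal.ofReal G) := by
      gcongr
      exact (lintegral_mono_set (Ioc_subset_Ioc_right ht.2)).trans hg
    _ = _ := by rw [← ENNReal.ofReal_add hint0 hG, ← ENNReal.ofReal_mul hM0]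
  rw [← ofReal_norm, ENNReal.ofReal_le_ofReal_iff (by positivity)] at hmain
  refine hmain.trans_eq ?_
  rw [intervalIntegral.integral_of_le ht.1, integral_const_mul]
  ring

/-- For `‖μ‖ ≤ δ` condition (SL4) gives `η`. For larger `μ` the crude bound from (SL3) is a multiple
of `2 + γ ‖μ‖₊`, and the constant `2` is absorbed because `γ ‖μ‖₊` is at least `γ δ > 0`. -/
theorem SemilinearAssumption.exists_norm_sub_zero_le {X U : Type*} [NormedAddCommGroup X]
    [NormedAddCommGroup U] {f : ℝ → X → U → X} {γ : ℝ≥0 → ℝ≥0} (hf : SemilinearAssumption f γ)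
    {R η : ℝ} (hR : 0 < R) (hη : 0 < η) : ∃ C : ℝ, 0 ≤ C ∧ ∀ t : ℝ, 0 ≤ t → ∀ (ξ : X) (μ : U), ‖ξ‖ ≤ R →
      ‖f t ξ μ - f t ξ 0‖ ≤ η + C * γ ‖μ‖₊ := by
  obtain ⟨N, hN, -, hfN⟩ := hf.sl3
  obtain ⟨δ, hδ, hfδ⟩ := hf.sl4 R hR η hη
  have hγ := hf.sl3_gain
  set d : ℝ≥0 := ⟨δ, hδ.le⟩
  have hd : (0 : ℝ) < γ d := by
    have : γ 0 < γ d := hγ.strictMono (show (0 : ℝ≥0) < d from hδ)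
    rw [hγ.map_zero] at this
    exact_mod_cast this
  set n : ℝ := (N R.toNNReal : ℝ)
  have hn : 0 ≤ n := NNReal.coe_nonneg _
  refine ⟨n * (2 / γ d + 1), by positivity, fun t ht ξ μ hξ => ?_⟩
  rcases le_or_gt ‖μ‖ δ with h | h
  · exact (hfδ t ht ξ μ hξ h).le.trans (le_add_of_nonneg_right (by positivity))
  · have hb : ∀ ν : U, ‖f t ξ ν‖ ≤ n * (1 + γ ‖ν‖₊) := by
      intro ν
      have h1 : N ‖ξ‖₊ ≤ N R.toNNReal := hN (by
        rw [← NNReal.coe_le_coe]; simpa [hR.le] using hξ)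
      have h2 : ‖f t ξ ν‖₊ ≤ N R.toNNReal * (1 + γ ‖ν‖₊) :=
        (hfN t ht ξ ν).trans (mul_le_mul_left h1 _)
      exact_mod_cast h2
    have h0 := hb 0
    rw [nnnorm_zero, hγ.map_zero] at h0
    have hg : (γ d : ℝ) ≤ γ ‖μ‖₊ := by
      have : γ d ≤ γ ‖μ‖₊ := hγ.strictMono.monotone (show d ≤ ‖μ‖₊ from h.le)
      exact_mod_cast this
    have h2 : (2 : ℝ) ≤ 2 / γ d * γ ‖μ‖₊ := by
      rw [div_mul_eq_mul_div, le_div_iff₀ hd]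
      linarith
    calc ‖f t ξ μ - f t ξ 0‖ ≤ ‖f t ξ μ‖ + ‖f t ξ 0‖ := norm_sub_le _ _
      _ ≤ n * (1 + γ ‖μ‖₊) + n * (1 + (0 : ℝ≥0)) := add_le_add (hb μ) h0
      _ = n * (2 + γ ‖μ‖₊) := by push_cast; ring
      _ ≤ n * (2 / γ d * γ ‖μ‖₊ + γ ‖μ‖₊) := by gcongr
      _ = n * (2 / γ d + 1) * γ ‖μ‖₊ := by ring
      _ ≤ _ := le_add_of_nonneg_left hη.le

variable [NormedAddCommGroup U]

/-- On windows of fixed length, bounded solutions stay close to the zero-input solutions if the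
input energy in the window is small. -/
theorem SemilinearAssumption.exists_norm_sub_le [CompleteSpace X] (hT : IsC0Semigroup T)
    (hf : SemilinearAssumption f γ) {R τ ε : ℝ} (hR : 0 < R) (hτ : 0 < τ) (hε : 0 < ε) :
    ∃ δ : ℝ, 0 < δ ∧ ∀ (s : ℝ) (ξ : X) (u : ℝ → U) (x y : ℝ → X), 0 ≤ s →
      IsMildSolution T f s ξ u (Ici s) x → IsMildSolution T f s ξ (fun _ => 0) (Ici s) y →
      (∀ t ∈ Icc s (s + τ), ‖x t‖ ≤ R) → (∀ t ∈ Icc s (s + τ), ‖y t‖ ≤ R) →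
      ∫⁻ r in Ioc s (s + τ), (γ ‖u r‖₊ : ℝ≥0∞) ≤ ENNReal.ofReal δ →
      ∀ t ∈ Icc s (s + τ), ‖x t - y t‖ ≤ ε := by
  obtain ⟨M, hM0, hM⟩ := hT.exists_norm_le τ
  obtain ⟨L, hL0, hL⟩ := hf.sl2 R hR
  set E : ℝ := M * Real.exp (M * L * τ)
  have hE : 0 ≤ E := by positivity
  -- The Grönwall bound is `(η * τ + C * δ) * E`; `η` here and `δ` below each use half of `ε`. The
  -- `+ 1` keeps the denominators positive.
  set η : ℝ := ε / (2 * (τ * E + 1))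
  have hη : 0 < η := by positivity
  obtain ⟨C, hC0, hC⟩ := hf.exists_norm_sub_zero_le hR hη
  refine ⟨ε / (2 * (C * E + 1)), by positivity, fun s ξ u x y hs hx hy hxR hyR hu t ht => ?_⟩
  set δ : ℝ := ε / (2 * (C * E + 1))
  have hδ : 0 < δ := by positivity
  have h1 : η * τ * E ≤ ε / 2 := by
    rw [show η * τ * E = ε / 2 * (τ * E / (τ * E + 1)) by simp only [η]; field_simp]
    exact mul_le_of_le_one_right (by positivity) (div_le_one_of_le₀ (by linarith) (by positivity))
  have h2 : C * δ * E ≤ ε / 2 := by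
    rw [show C * δ * E = ε / 2 * (C * E / (C * E + 1)) by simp only [δ]; field_simp]
    exact mul_le_of_le_one_right (by positivity) (div_le_one_of_le₀ (by linarith) (by positivity))
  have key := hx.norm_sub_le hy (b := s + τ) (M := M) (L := L) (G := η * τ + C * δ)
    (g := fun r => ENNReal.ofReal η + ENNReal.ofReal C * (γ ‖u r‖₊ : ℝ≥0∞)) hM0
    (by simpa using hM) hL0 (by positivity) ?_ ?_ t ht
  · refine key.trans ?_
    have hexp : Real.exp (M * L * (t - s)) ≤ Real.exp (M * L * τ) :=
      Real.exp_le_exp.2 (mul_le_mul_of_nonneg_left (by linarith [ht.2]) (by positivity))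
    calc M * (η * τ + C * δ) * Real.exp (M * L * (t - s))
        ≤ M * (η * τ + C * δ) * Real.exp (M * L * τ) :=
          mul_le_mul_of_nonneg_left hexp (by positivity)
      _ = η * τ * E + C * δ * E := by simp only [E]; ring
      _ ≤ ε := by linarith
  · rw [lintegral_add_left measurable_const, lintegral_const_mul' _ _ ENNReal.ofReal_ne_top,
      ENNReal.ofReal_add (by positivity) (by positivity), ENNReal.ofReal_mul hη.le,
      ENNReal.ofReal_mul hC0]
    gcongr
    simp
  · intro r hr
    have hr' := Ioc_subset_Icc_self hr
    have hr0 : 0 ≤ r := hs.trans hr'.1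
    have h : ‖f r (x r) (u r) - f r (y r) 0‖ ≤ L * ‖x r - y r‖ + (η + C * γ ‖u r‖₊) := calc
      _ ≤ ‖f r (x r) (u r) - f r (x r) 0‖ + ‖f r (x r) 0 - f r (y r) 0‖ :=
          norm_sub_le_norm_sub_add_norm_sub _ _ _
      _ ≤ (η + C * γ ‖u r‖₊) + L * ‖x r - y r‖ :=
          add_le_add (hC r hr0 _ _ (hxR r hr'))
            (hL _ _ (hxR r hr') (hyR r hr') 0 (by simpa using hR.le) r hr0)
      _ = L * ‖x r - y r‖ + (η + C * γ ‖u r‖₊) := add_comm _ _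
    rw [← ofReal_norm]
    refine (ENNReal.ofReal_le_ofReal h).trans_eq ?_
    rw [ENNReal.ofReal_add (by positivity) (by positivity),
      ENNReal.ofReal_add (by positivity) (by positivity), ENNReal.ofReal_mul hC0,
      ENNReal.ofReal_coe_nnreal]

/-- On a compact interval both solutions and the input are bounded, so a single Lipschitz constant
applies and Grönwall's inequality with no perturbation forces equality. -/
theorem SemilinearAssumption.eqOn_of_isMildSolution [CompleteSpace X] (hT : IsC0Semigroup T)
    (hf : SemilinearAssumption f γ) {s : ℝ} (hs : 0 ≤ s) {ξ : X} {u : ℝ → U}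
    (hu : PiecewiseContinuous u) {x y : ℝ → X} (hx : IsMildSolution T f s ξ u (Ici s) x)
    (hy : IsMildSolution T f s ξ u (Ici s) y) : EqOn x y (Ici s) := by
  intro b hb
  obtain ⟨B, hB⟩ := hu.exists_norm_le b
  obtain ⟨Cx, hCx⟩ := isCompact_Icc.exists_bound_of_continuousOn
    (hx.1.mono (Icc_subset_Ici_self : Icc s b ⊆ Ici s))
  obtain ⟨Cy, hCy⟩ := isCompact_Icc.exists_bound_of_continuousOn
    (hy.1.mono (Icc_subset_Ici_self : Icc s b ⊆ Ici s))
  set r : ℝ := max (max Cx Cy) (max B 1)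
  have hr1 : 1 ≤ r := (le_max_right _ _).trans (le_max_right _ _)
  obtain ⟨M, hM0, hM⟩ := hT.exists_norm_le (b - s)
  obtain ⟨L, hL0, hL⟩ := hf.sl2 r (zero_lt_one.trans_le hr1)
  have key := hx.norm_sub_le hy (b := b) (G := 0) (g := fun _ => 0) hM0 hM hL0 le_rfl (by simp)
    (fun q hq => by
      have hq' := Ioc_subset_Icc_self hq
      have hq0 := hs.trans hq'.1
      rw [add_zero, ← ofReal_norm]
      refine ENNReal.ofReal_le_ofReal (hL _ _ ?_ ?_ _ ?_ q hq0)
      · exact (hCx q hq').trans ((le_max_left _ _).trans (le_max_left _ _))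
      · exact (hCy q hq').trans ((le_max_right _ _).trans (le_max_left _ _))
      · exact (hB q ⟨hq0, hq'.2⟩).trans ((le_max_left _ _).trans (le_max_right _ _)))
    b ⟨hb, le_rfl⟩
  rw [mul_zero, zero_mul] at key
  exact sub_eq_zero.1 (norm_le_zero_iff.1 key)

/-- An infinite existence time excludes the dummy value of `maximalSolution`, whose existence time
is the finite `t₀`. -/
theorem isMildSolution_of_maxTime_eq_top {t₀ : ℝ} {x₀ : X} {u : ℝ → U}
    (h : (semilinearSystem T f).maxTime t₀ x₀ u = ⊤) :
    IsMildSolution T f t₀ x₀ u (Ici t₀) (fun t => (semilinearSystem T f).φ t t₀ x₀ u) := by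
  change (maximalSolution T f t₀ x₀ u).1 = ⊤ at h
  change IsMildSolution T f t₀ x₀ u (Ici t₀) (maximalSolution T f t₀ x₀ u).2
  by_cases he : ∃ p : EReal × (ℝ → X), IsMaximalMildSolution T f t₀ x₀ u p.1 p.2
  · have hmax : maximalSolution T f t₀ x₀ u = he.choose := dif_pos he
    rw [hmax] at h ⊢
    have := he.choose_spec.isMildSolution
    rw [h] at this
    convert this using 1
    ext t
    simp [EReal.coe_lt_top]
  · have hmax : maximalSolution T f t₀ x₀ u = ((t₀ : EReal), fun _ => 0) := dif_neg he
    rw [hmax] at h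
    exact absurd h (EReal.coe_ne_top _)

end

section

/-! ### Stability properties of transition systems -/

theorem ClassK.exists_pos_le {α : ℝ≥0 → ℝ≥0} (hα : ClassK α) {ε : ℝ≥0} (hε : 0 < ε) :
    ∃ δ, 0 < δ ∧ α δ ≤ ε := by
  have h : Tendsto α (𝓝 0) (𝓝 0) := by simpa [hα.map_zero] using hα.continuous.tendsto 0
  have h' : ∀ᶠ δ in 𝓝[>] (0 : ℝ≥0), α δ < ε :=
    (h.eventually (gt_mem_nhds hε)).filter_mono nhdsWithin_le_nhds
  obtain ⟨δ, hδ, hδ0⟩ := (h'.and self_mem_nhdsWithin).exists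
  exact ⟨δ, hδ0, hδ.le⟩

theorem ClassKL.exists_pos_le {β : ℝ≥0 → ℝ≥0 → ℝ≥0} (hβ : ClassKL β) (r : ℝ≥0) {ε : ℝ≥0}
    (hε : 0 < ε) : ∃ τ, 0 < τ ∧ β r τ ≤ ε := by
  obtain ⟨τ, h, h0⟩ := (((hβ.tendsto_zero r).eventually (gt_mem_nhds hε)).and
    (eventually_gt_atTop 0)).exists
  exact ⟨τ, h0, h.le⟩

theorem ClassKInfty.add {α β : ℝ≥0 → ℝ≥0} (hα : ClassKInfty α) (hβ : ClassK β) :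
    ClassKInfty fun r => α r + β r where
  continuous := hα.continuous.add hβ.continuous
  strictMono := hα.strictMono.add hβ.strictMono
  map_zero := by simp [hα.map_zero, hβ.map_zero]
  unbounded M := (hα.unbounded M).imp fun _ h => h.trans_le (le_add_right le_rfl)

theorem ClassKInfty.max {α β : ℝ≥0 → ℝ≥0} (hα : ClassKInfty α) (hβ : ClassKInfty β) :
    ClassKInfty fun r => max (α r) (β r) where
  continuous := hα.continuous.max hβ.continuous
  strictMono _ _ h := max_lt_max (hα.strictMono h) (hβ.strictMono h)
  map_zero := by simp [hα.map_zero, hβ.map_zero]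
  unbounded M := (hα.unbounded M).imp fun _ h => h.trans_le (le_max_left _ _)

theorem classKInfty_id : ClassKInfty fun r => r :=
  ⟨⟨continuous_id, strictMono_id, rfl⟩, fun M => ⟨M + 1, by simp⟩⟩

theorem extendTop_le {ρ : ℝ≥0 → ℝ≥0} (hρ : Monotone ρ) {e : ℝ≥0∞} {b : ℝ≥0} (h : e ≤ b) :
    extendTop ρ e ≤ ρ b := by
  have he : e ≠ ∞ := ne_top_of_le_ne_top ENNReal.coe_ne_top h
  rw [extendTop, if_neg he, ENNReal.coe_le_coe]
  exact hρ (by simpa using ENNReal.toNNReal_mono ENNReal.coe_ne_top h)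

theorem extendTop_mono {ρ : ℝ≥0 → ℝ≥0} (hρ : Monotone ρ) : Monotone (extendTop ρ) := by
  intro a b hab
  by_cases hb : b = ∞
  · simp [extendTop, hb]
  · conv_rhs => rw [extendTop, if_neg hb]
    exact extendTop_le hρ (by rwa [ENNReal.coe_toNNReal hb])

/-- Pigeonhole: the `n` consecutive half-open windows are disjoint, so if each carried more than
`δ`, the total would be at least `n * δ > e`. -/
theorem exists_window_lintegral_le {g : ℝ → ℝ≥0∞} {t₀ τ : ℝ} (ht₀ : 0 ≤ t₀) (hτ : 0 ≤ τ)
    {e δ : ℝ≥0} {n : ℕ} (hg : ∫⁻ s in Ici (0 : ℝ), g s ≤ e) (hn : e < n * δ) :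
    ∃ k < n, ∫⁻ s in Ioc (t₀ + k * τ) (t₀ + k * τ + τ), g s ≤ δ := by
  by_contra! h
  set p : ℕ → ℝ := fun k => t₀ + k * τ
  have hp : Monotone p := fun i j hij => by
    have : (i : ℝ) ≤ j := by exact_mod_cast hij
    simp only [p]
    gcongr
  have hsucc : ∀ k : ℕ, Ioc (t₀ + k * τ) (t₀ + k * τ + τ) = Ioc (p k) (p (k + 1)) := fun k => by
    simp only [p]; push_cast; congr 1; ring
  have hsum : ∑ k ∈ Finset.range n, ∫⁻ s in Ioc (p k) (p (k + 1)), g s ≤ e := by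
    have hd : Pairwise (Function.onFun Disjoint fun k => Ioc (p k) (p (k + 1))) :=
      hp.pairwise_disjoint_on_Ioc_succ
    rw [← lintegral_biUnion_finset (hd.set_pairwise _) fun _ _ => measurableSet_Ioc]
    refine (lintegral_mono_set ?_).trans hg
    refine iUnion₂_subset fun k _ s hs => ?_
    have : 0 ≤ p k := add_nonneg ht₀ (by positivity)
    exact this.trans hs.1.le
  have hle : ((n * δ : ℝ≥0) : ℝ≥0∞) ≤
      ∑ k ∈ Finset.range n, ∫⁻ s in Ioc (p k) (p (k + 1)), g s := by
    have := Finset.sum_le_sum fun k (hk : k ∈ Finset.range n) =>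
      (h k (Finset.mem_range.1 hk)).le
    simp only [hsucc] at this
    simpa using this
  exact not_lt.2 (ENNReal.coe_le_coe.1 (hle.trans hsum)) hn

variable {X U : Type*} [NormedAddCommGroup X] [NormedAddCommGroup U]

theorem energy_mono {κ κ' : ℝ≥0 → ℝ≥0} (h : ∀ r, κ r ≤ κ' r) (u : ℝ → U) :
    energy κ u ≤ energy κ' u :=
  lintegral_mono fun _ => ENNReal.coe_le_coe.2 (h _)

theorem energy_zero {κ : ℝ≥0 → ℝ≥0} (hκ : κ 0 = 0) : energy κ (fun _ => (0 : U)) = 0 := by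
  simp [energy, hκ]

theorem UBEBS.mono {S : TransitionSystem X U} {κ κ' : ℝ≥0 → ℝ≥0} (hS : UBEBS S κ)
    (hκ' : ClassKInfty κ') (h : ∀ r, κ r ≤ κ' r) : UBEBS S κ' := by
  obtain ⟨-, hfc, α, ρ, c, hα, hρ, hb⟩ := hS
  refine ⟨hκ', hfc, α, ρ, c, hα, hρ, fun t₀ ht₀ x₀ u hu t ht => (hb t₀ ht₀ x₀ u hu t ht).trans ?_⟩
  gcongr
  exact extendTop_mono hρ.strictMono.monotone (energy_mono h u)

theorem UBEBS.exists_nnnorm_le {S : TransitionSystem X U} {κ : ℝ≥0 → ℝ≥0} (hS : UBEBS S κ)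
    (r : ℝ≥0) : ∃ B : ℝ≥0, ∀ t₀ : ℝ, 0 ≤ t₀ → ∀ x₀ : X, ∀ u ∈ S.inputs, ‖x₀‖₊ ≤ r →
      energy κ u ≤ r → ∀ t, t₀ ≤ t → ‖S.φ t t₀ x₀ u‖₊ ≤ B := by
  obtain ⟨-, -, α, ρ, c, hα, hρ, hb⟩ := hS
  refine ⟨c + α r + ρ r, fun t₀ ht₀ x₀ u hu hx he t ht => ?_⟩
  rw [← ENNReal.coe_le_coe]
  refine (hb t₀ ht₀ x₀ u hu t ht).trans ?_
  push_cast
  gcongr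
  · exact hα.strictMono.monotone hx
  · exact extendTop_le hρ.strictMono.monotone he

theorem IntegralISS.zeroGUAS {S : TransitionSystem X U} {κ : ℝ≥0 → ℝ≥0} (hS : IntegralISS S κ)
    (h0 : (fun _ => 0) ∈ S.inputs) : ZeroGUAS S := by
  obtain ⟨hκ, hfc, ρ, β, hρ, hβ, hb⟩ := hS
  refine ⟨β, hβ, fun t₀ ht₀ x₀ => ⟨hfc t₀ ht₀ x₀ _ h0, fun t ht => ?_⟩⟩
  have := hb t₀ ht₀ x₀ _ h0 t ht
  rw [energy_zero hκ.map_zero] at this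
  simpa [extendTop, hρ.map_zero] using this

theorem IntegralISS.uBEBS {S : TransitionSystem X U} {κ : ℝ≥0 → ℝ≥0} (hS : IntegralISS S κ) :
    UBEBS S κ := by
  obtain ⟨hκ, hfc, ρ, β, hρ, hβ, hb⟩ := hS
  -- The summand `r` makes the bound unbounded, as `β r 0` need not be.
  refine ⟨hκ, hfc, fun r => r + β r 0, ρ, 0, classKInfty_id.add (hβ.classK 0), hρ,
    fun t₀ ht₀ x₀ u hu t ht => (hb t₀ ht₀ x₀ u hu t ht).trans ?_⟩
  rw [ENNReal.coe_zero, zero_add]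
  gcongr
  exact (hβ.antitone _ zero_le).trans (le_add_left le_rfl)

/-- The transition map satisfies the cocycle identity. -/
def IsCocycle (S : TransitionSystem X U) : Prop :=
  ∀ t₀ : ℝ, 0 ≤ t₀ → ∀ x₀ : X, ∀ u ∈ S.inputs, ∀ s t : ℝ, t₀ ≤ s → s ≤ t →
    S.φ t s (S.φ s t₀ x₀ u) u = S.φ t t₀ x₀ u

/-- On windows of fixed length, bounded trajectories stay close to zero-input trajectories when
the energy of the input in the window is small. -/
def CloseToZeroInput (S : TransitionSystem X U) (κ : ℝ≥0 → ℝ≥0) : Prop :=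
  ∀ R τ ε : ℝ≥0, 0 < τ → 0 < ε → ∃ δ : ℝ≥0, 0 < δ ∧
    ∀ s : ℝ, 0 ≤ s → ∀ ξ : X, ∀ u ∈ S.inputs, (∀ t ∈ Icc s (s + τ), ‖S.φ t s ξ u‖₊ ≤ R) →
      ∫⁻ r in Ioc s (s + τ), (κ ‖u r‖₊ : ℝ≥0∞) ≤ δ →
      ∀ t ∈ Icc s (s + τ), ‖S.φ t s ξ u‖₊ ≤ ‖S.φ t s ξ (fun _ => 0)‖₊ + ε

/-! ### From 0-GUAS and UBEBS to iISS -/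

variable {S : TransitionSystem X U} {κ : ℝ≥0 → ℝ≥0}

/-- Trajectories stay small if the initial state and the energy are small. -/
theorem exists_nnnorm_le_of_small (hcoc : IsCocycle S) (hclose : CloseToZeroInput S κ)
    (h0 : ZeroGUAS S) (hb : UBEBS S κ) {ε : ℝ≥0} (hε : 0 < ε) :
    ∃ δ, 0 < δ ∧ ∀ t₀ : ℝ, 0 ≤ t₀ → ∀ x₀ : X, ∀ u ∈ S.inputs, ‖x₀‖₊ ≤ δ → energy κ u ≤ δ →
      ∀ t, t₀ ≤ t → ‖S.φ t t₀ x₀ u‖₊ ≤ ε := by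
  obtain ⟨β, hβ, hβ0⟩ := h0
  -- The radius `δ₁` gives `β δ₁ 0 + δ₁ / 2 ≤ ε`, so a window started in the `δ₁`-ball stays within
  -- `ε`. The length `τ` gives `β δ₁ τ + δ₁ / 2 ≤ δ₁`, so the state is back in the `δ₁`-ball at its
  -- end and the argument repeats.
  obtain ⟨δ₀, hδ₀, hβδ⟩ := (hβ.classK 0).exists_pos_le (half_pos hε)
  set δ₁ := min δ₀ (ε / 2)
  have hδ₁ : 0 < δ₁ := lt_min hδ₀ (half_pos hε)
  have hβδ₁ : β δ₁ 0 ≤ ε / 2 := ((hβ.classK 0).strictMono.monotone (min_le_left _ _)).trans hβδ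
  obtain ⟨τ, hτ, hβτ⟩ := hβ.exists_pos_le δ₁ (half_pos hδ₁)
  obtain ⟨R, hR⟩ := hb.exists_nnnorm_le δ₁
  obtain ⟨δ₂, hδ₂, hdev⟩ := hclose R τ (δ₁ / 2) hτ (half_pos hδ₁)
  have hτ' : (0 : ℝ) < τ := hτ
  refine ⟨min δ₁ δ₂, lt_min hδ₁ hδ₂, fun t₀ ht₀ x₀ u hu hx he => ?_⟩
  have he₁ : energy κ u ≤ δ₁ := he.trans (ENNReal.coe_le_coe.2 (min_le_left _ _))
  have hwin : ∀ (s : ℝ) (ξ : X), 0 ≤ s → ‖ξ‖₊ ≤ δ₁ → ∀ t ∈ Icc s (s + τ),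
      ‖S.φ t s ξ u‖₊ ≤ β δ₁ (t - s).toNNReal + δ₁ / 2 := by
    intro s ξ hs hξ t ht
    refine (hdev s hs ξ u hu (fun t ht => hR s hs ξ u hu hξ he₁ t ht.1) ?_ t ht).trans ?_
    · refine (lintegral_mono_set ?_).trans (he.trans (ENNReal.coe_le_coe.2 (min_le_right _ _)))
      exact fun r hr => hs.trans hr.1.le
    · gcongr
      exact ((hβ0 s hs ξ).2 t ht.1).trans ((hβ.classK _).strictMono.monotone hξ)
  have key : ∀ (k : ℕ) (s : ℝ) (ξ : X), 0 ≤ s → ‖ξ‖₊ ≤ δ₁ → ∀ t, s ≤ t → t ≤ s + k * τ →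
      ‖S.φ t s ξ u‖₊ ≤ ε := by
    intro k
    have hfirst : ∀ (s : ℝ) (ξ : X), 0 ≤ s → ‖ξ‖₊ ≤ δ₁ → ∀ t ∈ Icc s (s + τ),
        ‖S.φ t s ξ u‖₊ ≤ ε := by
      intro s ξ hs hξ t ht
      refine (hwin s ξ hs hξ t ht).trans ?_
      calc β δ₁ (t - s).toNNReal + δ₁ / 2 ≤ ε / 2 + ε / 2 :=
            add_le_add ((hβ.antitone _ zero_le).trans hβδ₁)
              ((half_le_self zero_le).trans (min_le_right _ _))
        _ = ε := add_halves ε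
    induction k with
    | zero =>
      intro s ξ hs hξ t ht ht'
      exact hfirst s ξ hs hξ t ⟨ht, ht'.trans (by simp)⟩
    | succ k ih =>
      intro s ξ hs hξ t ht ht'
      rcases le_total t (s + τ) with h | h
      · exact hfirst s ξ hs hξ t ⟨ht, h⟩
      · rw [← hcoc s hs ξ u hu (s + τ) t (by linarith) h]
        refine ih _ _ (by linarith) ?_ t h (by push_cast at ht'; linarith)
        refine (hwin s ξ hs hξ (s + τ) ⟨by linarith, le_rfl⟩).trans ?_
        rw [add_sub_cancel_left, Real.toNNReal_coe]
        exact (add_le_add_left hβτ _).trans_eq (add_halves δ₁)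
  intro t ht
  obtain ⟨k, hk⟩ := exists_nat_ge ((t - t₀) / τ)
  rw [div_le_iff₀ hτ'] at hk
  exact key k t₀ x₀ ht₀ (hx.trans (min_le_left _ _)) t ht (by linarith)

/-- UBEBS supplies boundedness and the preceding lemma smallness near zero, both in terms of the
maximum of `‖x₀‖₊` and `e`; a `𝒦∞` majorant of that maximum splits into a sum. -/
theorem exists_nnnorm_le_add (hcoc : IsCocycle S) (hclose : CloseToZeroInput S κ)
    (h0 : ZeroGUAS S) (hb : UBEBS S κ) :
    ∃ θ, ClassKInfty θ ∧ ∀ t₀ : ℝ, 0 ≤ t₀ → ∀ x₀ : X, ∀ u ∈ S.inputs, ∀ e : ℝ≥0,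
      energy κ u ≤ e → ∀ t, t₀ ≤ t → ‖S.φ t t₀ x₀ u‖₊ ≤ θ ‖x₀‖₊ + θ e := by
  obtain ⟨θ, hθ, h⟩ := exists_classKInfty_majorant
    (fun n v => ∃ t₀ : ℝ, 0 ≤ t₀ ∧ ∃ x₀ : X, ∃ u ∈ S.inputs, ∃ t, t₀ ≤ t ∧ ‖x₀‖₊ ≤ n ∧
      energy κ u ≤ n ∧ v = ‖S.φ t t₀ x₀ u‖₊)
    (fun r => by
      obtain ⟨B, hB⟩ := hb.exists_nnnorm_le r
      refine ⟨B, ?_⟩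
      rintro n v ⟨t₀, ht₀, x₀, u, hu, t, ht, hx, he, rfl⟩ hn
      exact hB t₀ ht₀ x₀ u hu (hx.trans hn) (he.trans (ENNReal.coe_le_coe.2 hn)) t ht)
    (fun ε hε => by
      obtain ⟨δ, hδ, h⟩ := exists_nnnorm_le_of_small hcoc hclose h0 hb hε
      refine ⟨δ, hδ, ?_⟩
      rintro n v ⟨t₀, ht₀, x₀, u, hu, t, ht, hx, he, rfl⟩ hn
      exact h t₀ ht₀ x₀ u hu (hx.trans hn) (he.trans (ENNReal.coe_le_coe.2 hn)) t ht)
  refine ⟨θ, hθ, fun t₀ ht₀ x₀ u hu e he t ht => ?_⟩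
  refine (h (max ‖x₀‖₊ e) _ ⟨t₀, ht₀, x₀, u, hu, t, ht, le_max_left _ _,
    he.trans (ENNReal.coe_le_coe.2 (le_max_right _ _)), rfl⟩).trans ?_
  rw [hθ.strictMono.monotone.map_max]
  exact max_le (le_add_right le_rfl) (le_add_left le_rfl)

/-- The time depends on `r` and `ε` but not on the energy: large energy makes the claim trivial, and
energy at most `r` leaves a low-energy window among a number of windows fixed by `r`. -/
theorem exists_time_nnnorm_le (hcoc : IsCocycle S) (hclose : CloseToZeroInput S κ)
    (h0 : ZeroGUAS S) {θ : ℝ≥0 → ℝ≥0} (hθ : ClassKInfty θ)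
    (hb : ∀ t₀ : ℝ, 0 ≤ t₀ → ∀ x₀ : X, ∀ u ∈ S.inputs, ∀ e : ℝ≥0,
      energy κ u ≤ e → ∀ t, t₀ ≤ t → ‖S.φ t t₀ x₀ u‖₊ ≤ θ ‖x₀‖₊ + θ e)
    (r : ℝ≥0) {ε : ℝ≥0} (hε : 0 < ε) :
    ∃ T : ℝ≥0, ∀ t₀ : ℝ, 0 ≤ t₀ → ∀ x₀ : X, ∀ u ∈ S.inputs, ∀ e : ℝ≥0, energy κ u ≤ e →
      ‖x₀‖₊ ≤ r → ∀ t, t₀ + T ≤ t → ‖S.φ t t₀ x₀ u‖₊ ≤ ε + (θ e + θ e) := by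
  have hmono := hθ.strictMono.monotone
  obtain ⟨β, hβ, hβ0⟩ := h0
  obtain ⟨δ, hδ, hθδ⟩ := hθ.toClassK.exists_pos_le hε
  set R := θ r + θ r
  obtain ⟨τ, hτ, hβτ⟩ := hβ.exists_pos_le R (half_pos hδ)
  obtain ⟨δ₂, hδ₂, hdev⟩ := hclose R τ (δ / 2) hτ (half_pos hδ)
  obtain ⟨n, hn⟩ := exists_nat_gt (r / δ₂)
  rw [div_lt_iff₀ hδ₂] at hn
  have hτ' : (0 : ℝ) < τ := hτ
  refine ⟨n * τ, fun t₀ ht₀ x₀ u hu e he hx t ht => ?_⟩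
  push_cast at ht
  have hnτ : (0 : ℝ) ≤ n * τ := by positivity
  -- If `r ≤ e`, then `θ ‖x₀‖₊ ≤ θ e` and the bound `hb` suffices. Otherwise `e ≤ r < n * δ₂`, and
  -- some window has energy at most `δ₂`.
  rcases le_total r e with hre | her
  · exact (hb t₀ ht₀ x₀ u hu e he t (by linarith)).trans
      (le_add_left (add_le_add_left (hmono (hx.trans hre)) _))
  · obtain ⟨k, hk, hwin⟩ := exists_window_lintegral_le ht₀ hτ'.le he (her.trans_lt hn)
    set s : ℝ := t₀ + k * τ
    have hs₀ : t₀ ≤ s := le_add_of_nonneg_right (by positivity)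
    have hs : 0 ≤ s := ht₀.trans hs₀
    have hsn : s + τ ≤ t := by
      have : ((k : ℝ) + 1) * τ ≤ n * τ :=
        mul_le_mul_of_nonneg_right (by exact_mod_cast hk) hτ'.le
      simp only [s]
      linarith
    have hbR : ∀ q, t₀ ≤ q → ‖S.φ q t₀ x₀ u‖₊ ≤ R := fun q hq =>
      (hb t₀ ht₀ x₀ u hu e he q hq).trans (add_le_add (hmono hx) (hmono her))
    have hend := hdev s hs (S.φ s t₀ x₀ u) u hu (fun q hq => by
      rw [hcoc t₀ ht₀ x₀ u hu s q hs₀ hq.1]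
      exact hbR q (hs₀.trans hq.1)) hwin (s + τ) ⟨by linarith, le_rfl⟩
    have hz := (hβ0 s hs (S.φ s t₀ x₀ u)).2 (s + τ) (by linarith)
    rw [add_sub_cancel_left, Real.toNNReal_coe] at hz
    rw [hcoc t₀ ht₀ x₀ u hu s (s + τ) hs₀ (by linarith)] at hend
    have hsmall : ‖S.φ (s + τ) t₀ x₀ u‖₊ ≤ δ := hend.trans <| calc
      _ ≤ δ / 2 + δ / 2 := add_le_add_left
          (hz.trans (((hβ.classK τ).strictMono.monotone (hbR s hs₀)).trans hβτ)) _
      _ = δ := add_halves δ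
    rw [← hcoc t₀ ht₀ x₀ u hu (s + τ) t (by linarith) hsn]
    refine (hb (s + τ) (by linarith) _ u hu e he t hsn).trans ?_
    exact add_le_add ((hmono hsmall).trans hθδ) (le_add_left le_rfl)

/-- A zero-input stable system with bounded-energy input bounded state is integral input-to-state
stable if its trajectories depend on small inputs continuously. -/
theorem UBEBS.integralISS (hb : UBEBS S κ) (h0 : ZeroGUAS S) (hcoc : IsCocycle S)
    (hclose : CloseToZeroInput S κ) : IntegralISS S κ := by
  obtain ⟨θ, hθ, hle⟩ := exists_nnnorm_le_add hcoc hclose h0 hb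
  -- The quantity to majorize is the excess of the norm over the energy term `2 θ e`; truncated
  -- subtraction makes it zero when there is no excess.
  obtain ⟨β, hβ, hP⟩ := exists_classKL_majorant
    (fun n s v => ∃ t₀ : ℝ, 0 ≤ t₀ ∧ ∃ x₀ : X, ∃ u ∈ S.inputs, ∃ e : ℝ≥0, ∃ t, t₀ ≤ t ∧
      energy κ u ≤ e ∧ n = ‖x₀‖₊ ∧ s = (t - t₀).toNNReal ∧ v = ‖S.φ t t₀ x₀ u‖₊ - (θ e + θ e))
    hθ
    (by
      rintro n s v ⟨t₀, ht₀, x₀, u, hu, e, t, ht, he, rfl, rfl, rfl⟩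
      rw [tsub_le_iff_right]
      exact (hle t₀ ht₀ x₀ u hu e he t ht).trans (add_le_add_right (le_add_left le_rfl) _))
    (fun r ε hε => by
      obtain ⟨T, hT⟩ := exists_time_nnnorm_le hcoc hclose h0 hθ hle r hε
      refine ⟨T, ?_⟩
      rintro n s v ⟨t₀, ht₀, x₀, u, hu, e, t, ht, he, rfl, rfl, rfl⟩ hn hs
      rw [tsub_le_iff_right]
      refine hT t₀ ht₀ x₀ u hu e he hn t ?_
      rw [← NNReal.coe_le_coe, Real.coe_toNNReal _ (sub_nonneg.2 ht)] at hs
      linarith)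
  refine ⟨hb.1, hb.2.1, fun r => θ r + θ r, β, hθ.add hθ.toClassK, hβ,
    fun t₀ ht₀ x₀ u hu t ht => ?_⟩
  by_cases he : energy κ u = ∞
  · simp [extendTop, he]
  · rw [extendTop, if_neg he, ← ENNReal.coe_add, ENNReal.coe_le_coe, ← tsub_le_iff_right]
    exact hP _ _ _ ⟨t₀, ht₀, x₀, u, hu, _, t, ht, (ENNReal.coe_toNNReal he).ge, rfl, rfl, rfl⟩

end

section

/-! ### Semilinear systems as transition systems -/

variable {X U : Type*} [NormedAddCommGroup X] [NormedSpace ℝ X] [CompleteSpace X]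
  [NormedAddCommGroup U] {T : ℝ → X →L[ℝ] X} {f : ℝ → X → U → X} {γ : ℝ≥0 → ℝ≥0}

theorem SemilinearAssumption.isCocycle (hT : IsC0Semigroup T) (hf : SemilinearAssumption f γ)
    (hfc : ForwardComplete (semilinearSystem T f)) : IsCocycle (semilinearSystem T f) := by
  intro t₀ ht₀ x₀ u hu s t hs ht
  have hs0 := ht₀.trans hs
  exact hf.eqOn_of_isMildSolution hT hs0 hu
    (isMildSolution_of_maxTime_eq_top (hfc s hs0 _ u hu))
    ((isMildSolution_of_maxTime_eq_top (hfc t₀ ht₀ x₀ u hu)).restart hT hs) ht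

/-- The perturbation estimate needs a common bound on both trajectories: the perturbed one is
bounded by assumption, the zero-input one by 0-GUAS. -/
theorem SemilinearAssumption.closeToZeroInput (hT : IsC0Semigroup T)
    (hf : SemilinearAssumption f γ) (hfc : ForwardComplete (semilinearSystem T f))
    (h0 : ZeroGUAS (semilinearSystem T f)) {κ : ℝ≥0 → ℝ≥0} (hκ : ∀ r, γ r ≤ κ r) :
    CloseToZeroInput (semilinearSystem T f) κ := by
  obtain ⟨β, hβ, hβ0⟩ := h0
  intro R τ ε hτ hε
  set B : ℝ≥0 := max (R + 1) (β R 0)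
  have hB : (0 : ℝ) < B := by
    have : (0 : ℝ≥0) < B := lt_max_of_lt_left (by positivity)
    exact_mod_cast this
  obtain ⟨δ, hδ, h⟩ := hf.exists_norm_sub_le hT hB (τ := τ) (ε := ε) hτ hε
  refine ⟨δ.toNNReal, Real.toNNReal_pos.2 hδ, fun s hs ξ u hu hR he t ht => ?_⟩
  have hx := isMildSolution_of_maxTime_eq_top (hfc s hs ξ u hu)
  have hξ : ‖ξ‖₊ ≤ R := by
    -- The window contains its initial time, where the trajectory equals `ξ`, so the bound `R` also
    -- applies to `ξ`.
    have h1 := hR s ⟨le_rfl, by simp⟩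
    have h2 := (hx.2 s self_mem_Ici).2
    simp only [sub_self, hT.zero, intervalIntegral.integral_same, add_zero] at h2
    rwa [h2] at h1
  have hclose := h s ξ u _ _ hs hx (isMildSolution_of_maxTime_eq_top (hβ0 s hs ξ).1)
    (fun t ht => NNReal.coe_le_coe.2
      ((hR t ht).trans ((le_add_right le_rfl).trans (le_max_left _ _))))
    (fun t ht => NNReal.coe_le_coe.2 (((hβ0 s hs ξ).2 t ht.1).trans
      (((hβ.classK _).strictMono.monotone hξ).trans
        ((hβ.antitone _ zero_le).trans (le_max_right _ _)))))
    ((lintegral_mono fun _ => ENNReal.coe_le_coe.2 (hκ _)).trans he) t ht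
  rw [← NNReal.coe_le_coe]
  push_cast
  linarith [norm_le_norm_add_norm_sub' ((semilinearSystem T f).φ t s ξ u)
    ((semilinearSystem T f).φ t s ξ fun _ => 0)]

end

end IISS

end

theorem mainTheorem6 {X U : Type*}
    [NormedAddCommGroup X] [NormedSpace ℝ X] [CompleteSpace X]
    [NormedAddCommGroup U] [NormedSpace ℝ U]
    (A : X →ₗ.[ℝ] X) (T : ℝ → X →L[ℝ] X)
    (hT : IISS.IsC0Semigroup T) (hA : IISS.IsGenerator A T)
    (f : ℝ → X → U → X) (γ : ℝ≥0 → ℝ≥0) (hf : IISS.SemilinearAssumption f γ) :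
    (∀ κ : ℝ≥0 → ℝ≥0, IISS.IntegralISS (IISS.semilinearSystem T f) κ →
      IISS.ZeroGUAS (IISS.semilinearSystem T f) ∧
        IISS.UBEBS (IISS.semilinearSystem T f) κ) ∧
    (∀ α : ℝ≥0 → ℝ≥0, IISS.ZeroGUAS (IISS.semilinearSystem T f) →
      IISS.UBEBS (IISS.semilinearSystem T f) α →
        IISS.IntegralISS (IISS.semilinearSystem T f) (fun r => max (α r) (γ r))) := by
  refine ⟨fun κ h => ⟨h.zeroGUAS IISS.piecewiseContinuous_zero, h.uBEBS⟩, fun α h0 hb => ?_⟩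
  have hfc := hb.2.1
  exact (hb.mono (hb.1.max hf.sl3_gain) fun r => le_max_left _ _).integralISS h0
    (hf.isCocycle hT hfc) (hf.closeToZeroInput hT hfc h0 fun r => le_max_right _ _)
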